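/- Notation. $\mathbb G_2=\{(z_1+z_2,z_1z_2):|z_1|<1,|z_2|<1\}\subset\mathbb C^2$ is the symmetrized bidisc, $\Gamma=\overline{\mathbb G_2}$ its closure, $\partial\Gamma$ the topological boundary of $\Gamma$ in $\mathbb C^2$. For a compact set $X\subset\mathbb C^n$, $Rat(X)$ is the algebra of rational functions $p/q$ with $p,q$ polynomials and $q$ without zeros in $X$, and the distinguished boundary $bX$ is the intersection of all closed subsets $C\subseteq X$ on which every $f\in Rat(X)$ attains its maximum modulus over $X$. A polynomial $q\in\mathbb C[z_1,z_2]$ with zero set $Z(q)$ is $\Gamma$-distinguished if $Z(q)\cap\mathbb G_2\neq\emptyset$ and $Z(q)\cap\partial\Gamma=Z(q)\cap b\Gamma$. A commuting pair $(S,P)$ of bounded operators on a complex Hilbert space is a $\Gamma$-contraction if its Taylor joint spectrum lies in $\Gamma$ and $\|f(S,P)\|\le\sup_{\Gamma}|f|$ for all $f\in Rat(\Gamma)$; it is $\Gamma$-distinguished if moreover $q(S,P)=0$ for some $\Gamma$-distinguished polynomial $q$. With $D_P=(I-P^*P)^{1/2}$ and $\mathcal D_P=\overline{\operatorname{Ran}}\,D_P$,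 the fundamental operator of a $\Gamma$-contraction $(S,P)$ is the unique operator $A$ on $\mathcal D_P$ with numerical radius $\omega(A)\le 1$ and $S-S^*P=D_PAD_P$, where $\omega(A)=\sup\{|\langle Ax,x\rangle|:\|x\|=1\}$ (and $\omega(A)=0$ if $\mathcal D_P=\{0\}$). Proposition. Let $(S,P)$ be a $\Gamma$-contraction on a finite-dimensional complex Hilbert space $\mathcal H$ whose fundamental operator $A$ satisfies $\omega(A)<1$. Then $(S,P)$ is $\Gamma$-distinguished. Moreover, for the polynomial $f(z_1,z_2)=\det(A+z_2A^*-z_1I)$ (determinant on $\mathcal D_P$, equal to $1$ if $\mathcal D_P=\{0\}$): (i) if $P$ is not unitary, then $f$ is $\Gamma$-distinguished; (ii) $f(S,P)h=0$ for every $h\in\mathcal H$ that is orthogonal to all eigenvectors of $P$ with eigenvalue of modulus $1$; (iii) in particular, if $P$ has no eigenvalue of modulus $1$, then $f(S,P)=0$. -/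

import Mathlib

open scoped InnerProductSpace

noncomputable section

/-- The symmetrization map `π(z₁, z₂) = (z₁ + z₂, z₁ z₂)` on `ℂ²`. -/
def symmetrization (z : Fin 2 → ℂ) : Fin 2 → ℂ :=
  ![z 0 + z 1, z 0 * z 1]

/-- The (open) symmetrized bidisc `𝔾₂ = π(𝔻²)`. -/
def symmetrizedBidisc : Set (Fin 2 → ℂ) :=
  symmetrization '' {z | ‖z 0‖ < 1 ∧ ‖z 1‖ < 1}

/-- The closed symmetrized bidisc `Γ`, the closure of `𝔾₂`. -/
def Gam : Set (Fin 2 → ℂ) :=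
  closure symmetrizedBidisc

/-- `q` has no zero in `X`; the elements of `Rat(X)` are the quotients `p / q` of polynomials
with such a denominator `q`. -/
def ZeroFreeOn {n : ℕ} (q : MvPolynomial (Fin n) ℂ) (X : Set (Fin n → ℂ)) : Prop :=
  ∀ x ∈ X, MvPolynomial.eval x q ≠ 0

/-- A boundary for `X`: a closed subset `C` of `X` on which every function `p / q` in `Rat(X)`
attains its maximum modulus over `X`. -/
def IsBoundaryFor {n : ℕ} (X C : Set (Fin n → ℂ)) : Prop :=
  IsClosed C ∧ C ⊆ X ∧
    ∀ p q : MvPolynomial (Fin n) ℂ, ZeroFreeOn q X →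
      ∃ c ∈ C, ∀ x ∈ X,
        ‖MvPolynomial.eval x p / MvPolynomial.eval x q‖ ≤
          ‖MvPolynomial.eval c p / MvPolynomial.eval c q‖

/-- The distinguished boundary `bX` of a compact set `X`: the intersection of all boundaries
for `X`. -/
def distinguishedBoundary {n : ℕ} (X : Set (Fin n → ℂ)) : Set (Fin n → ℂ) :=
  ⋂₀ {C | IsBoundaryFor X C}

/-- The zero set `Z(p)` of a polynomial. -/
def zeroSet (p : MvPolynomial (Fin 2) ℂ) : Set (Fin 2 → ℂ) :=
  {z | MvPolynomial.eval z p = 0}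

/-- `p` is `Γ`-distinguished: `Z(p)` meets `𝔾₂`, and `Z(p) ∩ ∂Γ = Z(p) ∩ bΓ`. -/
def IsGammaDistinguishedPoly (p : MvPolynomial (Fin 2) ℂ) : Prop :=
  (zeroSet p ∩ symmetrizedBidisc).Nonempty ∧
    zeroSet p ∩ frontier Gam = zeroSet p ∩ distinguishedBoundary Gam

section Operators

variable {H : Type*} [NormedAddCommGroup H] [InnerProductSpace ℂ H]

/-- The operator `p(S, P)`, for a polynomial `p ∈ ℂ[z₁, z₂]` (with `X 0 = z₁`, `X 1 = z₂`)
and a commuting pair `(S, P)`. -/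
def polyEval (p : MvPolynomial (Fin 2) ℂ) (S P : H →L[ℂ] H) : H →L[ℂ] H :=
  ∑ m ∈ p.support, p.coeff m • (S ^ m 0 * P ^ m 1)

/-- Exactness of the Koszul complex `0 → H → H ⊕ H → H → 0` of a commuting pair `(a, b)`, with
maps `z ↦ (a z, b z)` and `(x, y) ↦ a y - b x`. -/
def KoszulExact (a b : H →L[ℂ] H) : Prop :=
  (∀ z, a z = 0 → b z = 0 → z = 0) ∧
    (∀ x y, a y - b x = 0 → ∃ z, x = a z ∧ y = b z) ∧
    ∀ w, ∃ x y, a y - b x = w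

/-- The Taylor joint spectrum `σ_T(S, P)` of a commuting pair: the points `(s, p)` for which the
Koszul complex of `(S - s, P - p)` is not exact. -/
def taylorSpectrum (S P : H →L[ℂ] H) : Set (Fin 2 → ℂ) :=
  {z | ¬ KoszulExact (S - z 0 • (1 : H →L[ℂ] H)) (P - z 1 • (1 : H →L[ℂ] H))}

/-- `X` is a spectral set for the commuting pair `(S, P)`: `σ_T(S, P) ⊆ X` and von Neumann's
inequality `‖f(S, P)‖ ≤ sup_X |f|` holds for every `f = p / q` in `Rat(X)`. Here
`f(S, P) = p(S, P) q(S, P)⁻¹`; the inverse exists by the spectral mapping theorem. -/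
def IsSpectralSet (X : Set (Fin 2 → ℂ)) (S P : H →L[ℂ] H) : Prop :=
  taylorSpectrum S P ⊆ X ∧
    ∀ p q : MvPolynomial (Fin 2) ℂ, ZeroFreeOn q X →
      ‖polyEval p S P * Ring.inverse (polyEval q S P)‖ ≤
        sSup ((fun x => ‖MvPolynomial.eval x p / MvPolynomial.eval x q‖) '' X)

/-- A `Γ`-contraction: a commuting pair of operators having `Γ` as a spectral set. -/
def IsGammaContraction (S P : H →L[ℂ] H) : Prop :=
  Commute S P ∧ IsSpectralSet Gam S P

/-- A `Γ`-distinguished `Γ`-contraction: a `Γ`-contraction annihilated by some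
`Γ`-distinguished polynomial. -/
def IsGammaDistinguished (S P : H →L[ℂ] H) : Prop :=
  IsGammaContraction S P ∧
    ∃ q : MvPolynomial (Fin 2) ℂ, IsGammaDistinguishedPoly q ∧ polyEval q S P = 0

/-- The numerical radius `ω(T) = sup {|⟨T x, x⟩| : ‖x‖ = 1}` (equal to `0` on the zero space). -/
def numericalRadius (T : H →L[ℂ] H) : ℝ :=
  sSup {r | ∃ x : H, ‖x‖ = 1 ∧ r = ‖⟪T x, x⟫_ℂ‖}

variable [CompleteSpace H]

/-- The defect operator `D_P = (I - P* P)^{1/2}` of a contraction `P`. -/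
def defectOp (P : H →L[ℂ] H) : H →L[ℂ] H :=
  CFC.sqrt (1 - star P * P)

/-- The defect space `𝒟_P`, the closure of the range of `D_P`. -/
abbrev defectSpace (P : H →L[ℂ] H) : Submodule ℂ H :=
  (LinearMap.range (defectOp P).toLinearMap).topologicalClosure

/-- `D_P h`, as an element of `𝒟_P`. -/
def toDefectSpace (P : H →L[ℂ] H) (h : H) : defectSpace P :=
  ⟨defectOp P h, Submodule.le_topologicalClosure _ ⟨h, rfl⟩⟩

/-- `A` is the fundamental operator of `(S, P)`: an operator on `𝒟_P` with `ω(A) ≤ 1` and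
`S - S* P = D_P A D_P`. -/
def IsFundamentalOperator (S P : H →L[ℂ] H) (A : defectSpace P →L[ℂ] defectSpace P) : Prop :=
  numericalRadius A ≤ 1 ∧
    ∀ h : H, (S - star S * P) h = defectOp P (A (toDefectSpace P h))

/-- The polynomial `det(A + z₂ A* - z₁ I) ∈ ℂ[z₁, z₂]` of an operator `A` on a finite-dimensional
Hilbert space, computed in a basis. -/
def pencilPoly [FiniteDimensional ℂ H] (A : H →L[ℂ] H) : MvPolynomial (Fin 2) ℂ :=
  let b := Module.finBasis ℂ H
  let C : ℂ → MvPolynomial (Fin 2) ℂ := fun c => MvPolynomial.C c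
  ((LinearMap.toMatrix b b A.toLinearMap).map C
    + (MvPolynomial.X 1 : MvPolynomial (Fin 2) ℂ) •
        (LinearMap.toMatrix b b (star A).toLinearMap).map C
    - (MvPolynomial.X 0 : MvPolynomial (Fin 2) ℂ) • 1).det

end Operators

end

open scoped ComplexConjugate Topology
open MvPolynomial (X C eval)

noncomputable section


/-! ### The symmetrized bidisc -/

/-! A point `(s, p)` with `|p| < 1` lies in `𝔾₂` as soon as `s = a + ā p` for some `|a| < 1`. At a
zero `(s, p)` of `f = det(A + z₂A* - z₁)` there is a unit vector `v` with `Av + pA*v = sv`; pairing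
with `v` gives exactly this form with `a = ⟨v, Av⟩`, and `|a| ≤ ω(A) < 1`. So the zeros of `f` on
`∂Γ` have `|p| = 1`, and such points of `Γ` belong to `bΓ` (`mem_distinguishedBoundary_Gam`).

For annihilation, the identity `D_P S = A D_P + A* D_P P` (`IsFundamentalOperator.defectMap_fst`)
and a determinant argument give `D_P f(S,P) = 0`. Since `f(S,P)` commutes with `P`, every power of
`P` is isometric on the range of `f(S,P)`; in finite dimension this kills `f(S,P)h` when `h` is
orthogonal to the unimodular eigenvectors of `P`.

On a unimodular eigenspace `P = μ`, `S = μS*` and hence `S² = μS*S`. There the characteristic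
polynomial of `S*S` yields the annihilating factors `z₁² - t z₂`, `0 ≤ t ≤ 4`, whose zeros with
`|z₂| < 1` also lie in `𝔾₂`. The product of both polynomials, times `z₁`, annihilates the pair. -/

lemma norm_lt_one_of_root {a p z : ℂ} (ha : ‖a‖ < 1) (hp : ‖p‖ < 1)
    (hz : z * z - (a + conj a * p) * z + p = 0) : ‖z‖ < 1 := by
  by_contra! h1
  have e : z * (z - a) = p * (conj a * z - 1) := by linear_combination hz
  -- The Blaschke factor identity: outside the disc `|āz - 1| ≤ |z - a|`, which contradicts `e`
  -- since `|p| < 1`.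
  have key : ‖conj a * z - 1‖ ^ 2 + (‖z‖ ^ 2 - 1) * (1 - ‖a‖ ^ 2) = ‖z - a‖ ^ 2 := by
    simp only [Complex.sq_norm, Complex.normSq_apply, Complex.sub_re, Complex.sub_im,
      Complex.mul_re, Complex.mul_im, Complex.conj_re, Complex.conj_im, Complex.one_re,
      Complex.one_im]
    ring
  have h2 : 0 ≤ (‖z‖ ^ 2 - 1) * (1 - ‖a‖ ^ 2) :=
    mul_nonneg (by nlinarith) (by nlinarith [norm_nonneg a])
  have h3 : ‖conj a * z - 1‖ ≤ ‖z - a‖ :=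
    (sq_le_sq₀ (norm_nonneg _) (norm_nonneg _)).1 (by linarith)
  have h4 : ‖z‖ * ‖z - a‖ = ‖p‖ * ‖conj a * z - 1‖ := by
    rw [← norm_mul, e, norm_mul]
  have h5 : 0 < ‖z - a‖ := by
    rw [norm_pos_iff, sub_ne_zero]
    rintro rfl
    linarith
  nlinarith [norm_nonneg p, norm_nonneg (conj a * z - 1)]

lemma exists_roots (s p : ℂ) : ∃ z w : ℂ, z + w = s ∧ z * w = p := by
  obtain ⟨d, hd⟩ := IsAlgClosed.exists_pow_nat_eq (s ^ 2 - 4 * p) (n := 2) (by norm_num)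
  refine ⟨(s + d) / 2, (s - d) / 2, by ring, ?_⟩
  linear_combination (-1 / 4) * hd

lemma mem_symmetrizedBidisc_of_eq {a : ℂ} {x : Fin 2 → ℂ} (ha : ‖a‖ < 1) (hp : ‖x 1‖ < 1)
    (hx : x 0 = a + conj a * x 1) : x ∈ symmetrizedBidisc := by
  obtain ⟨z, w, hs, hzw⟩ := exists_roots (x 0) (x 1)
  refine ⟨![z, w], ⟨?_, ?_⟩, ?_⟩
  · refine norm_lt_one_of_root ha hp ?_
    rw [← hx, ← hs, ← hzw, Matrix.cons_val_zero]
    ring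
  · refine norm_lt_one_of_root ha hp ?_
    rw [← hx, ← hs, ← hzw, Matrix.cons_val_one, Matrix.cons_val_fin_one]
    ring
  · ext i
    fin_cases i <;> simp [symmetrization, hs, hzw]

lemma mem_symmetrizedBidisc_of_norm_lt {x : Fin 2 → ℂ}
    (h : ‖x 0 - conj (x 0) * x 1‖ < 1 - ‖x 1‖ ^ 2) : x ∈ symmetrizedBidisc := by
  have h0 : 0 < 1 - ‖x 1‖ ^ 2 := (norm_nonneg _).trans_lt h
  have hp : ‖x 1‖ < 1 := by nlinarith [norm_nonneg (x 1)]
  have h0' : (1 - (‖x 1‖ : ℂ) ^ 2) ≠ 0 := by exact_mod_cast h0.ne'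
  refine mem_symmetrizedBidisc_of_eq
    (a := (x 0 - conj (x 0) * x 1) / (1 - (‖x 1‖ : ℂ) ^ 2)) ?_ hp ?_
  · have : ‖(1 - (‖x 1‖ : ℂ) ^ 2)‖ = 1 - ‖x 1‖ ^ 2 := by
      rw [show (1 - (‖x 1‖ : ℂ) ^ 2) = ((1 - ‖x 1‖ ^ 2 : ℝ) : ℂ) by push_cast; rfl,
        Complex.norm_real, Real.norm_of_nonneg h0.le]
    rw [norm_div, this, div_lt_one h0]
    exact h
  · simp only [map_div₀, map_sub, map_mul, map_one, map_pow, Complex.conj_conj,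
      Complex.conj_ofReal]
    field_simp
    linear_combination x 0 * (Complex.mul_conj' (x 1))

lemma norm_lt_of_mem_symmetrizedBidisc {x : Fin 2 → ℂ} (h : x ∈ symmetrizedBidisc) :
    ‖x 0 - conj (x 0) * x 1‖ < 1 - ‖x 1‖ ^ 2 := by
  obtain ⟨z, ⟨h0, h1⟩, rfl⟩ := h
  simp only [symmetrization, Matrix.cons_val_zero, Matrix.cons_val_one, Matrix.cons_val_fin_one]
  have e : z 0 + z 1 - conj (z 0 + z 1) * (z 0 * z 1) =
      z 0 * (1 - ‖z 1‖ ^ 2 : ℝ) + z 1 * (1 - ‖z 0‖ ^ 2 : ℝ) := by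
    push_cast
    rw [map_add]
    linear_combination (-z 1) * (Complex.mul_conj' (z 0)) - z 0 * (Complex.mul_conj' (z 1))
  have n0 := norm_nonneg (z 0)
  have n1 := norm_nonneg (z 1)
  rw [e]
  refine (norm_add_le _ _).trans_lt ?_
  rw [norm_mul, norm_mul, norm_mul, Complex.norm_real, Complex.norm_real,
    Real.norm_of_nonneg (by nlinarith), Real.norm_of_nonneg (by nlinarith)]
  -- This product is exactly the difference of the two sides of the remaining inequality.
  have : 0 < (1 - ‖z 0‖) * (1 - ‖z 1‖) * (1 - ‖z 0‖ * ‖z 1‖) :=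
    mul_pos (mul_pos (by linarith) (by linarith)) (by nlinarith)
  nlinarith

lemma isOpen_symmetrizedBidisc : IsOpen symmetrizedBidisc := by
  have : symmetrizedBidisc = {x | ‖x 0 - conj (x 0) * x 1‖ < 1 - ‖x 1‖ ^ 2} :=
    Set.ext fun x => ⟨norm_lt_of_mem_symmetrizedBidisc, mem_symmetrizedBidisc_of_norm_lt⟩
  rw [this]
  exact isOpen_lt (by fun_prop) (by fun_prop)

lemma exists_of_mem_Gam {x : Fin 2 → ℂ} (hx : x ∈ Gam) :
    ∃ z w : ℂ, ‖z‖ ≤ 1 ∧ ‖w‖ ≤ 1 ∧ x 0 = z + w ∧ x 1 = z * w := by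
  have hc : IsCompact (symmetrization '' Metric.closedBall 0 1) := by
    refine (isCompact_closedBall _ _).image ?_
    refine continuous_pi fun i => ?_
    fin_cases i <;> simp [symmetrization] <;> fun_prop
  have hsub : symmetrizedBidisc ⊆ symmetrization '' Metric.closedBall 0 1 := by
    refine Set.image_mono fun z hz => ?_
    rw [mem_closedBall_zero_iff, pi_norm_le_iff_of_nonneg zero_le_one]
    intro i
    fin_cases i
    exacts [hz.1.le, hz.2.le]
  obtain ⟨z, hz, rfl⟩ := closure_minimal hsub hc.isClosed hx
  rw [mem_closedBall_zero_iff, pi_norm_le_iff_of_nonneg zero_le_one] at hz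
  exact ⟨z 0, z 1, hz 0, hz 1, rfl, rfl⟩

lemma norm_zero_le_of_mem_Gam {x : Fin 2 → ℂ} (hx : x ∈ Gam) : ‖x 0‖ ≤ 2 := by
  obtain ⟨z, w, hz, hw, h0, -⟩ := exists_of_mem_Gam hx
  rw [h0]
  exact (norm_add_le _ _).trans (by linarith)

lemma norm_one_le_of_mem_Gam {x : Fin 2 → ℂ} (hx : x ∈ Gam) : ‖x 1‖ ≤ 1 := by
  obtain ⟨z, w, hz, hw, -, h1⟩ := exists_of_mem_Gam hx
  rw [h1, norm_mul]
  exact mul_le_one₀ hz (norm_nonneg _) hw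

lemma eq_conj_mul_of_mem_Gam {x : Fin 2 → ℂ} (hx : x ∈ Gam) (h : ‖x 1‖ = 1) :
    x 0 = conj (x 0) * x 1 := by
  obtain ⟨z, w, hz, hw, h0, h1⟩ := exists_of_mem_Gam hx
  rw [h1, norm_mul] at h
  have hz1 : ‖z‖ = 1 := le_antisymm hz (by nlinarith [norm_nonneg z, norm_nonneg w])
  have hw1 : ‖w‖ = 1 := le_antisymm hw (by nlinarith [norm_nonneg z, norm_nonneg w])
  have ez := Complex.mul_conj' z
  have ew := Complex.mul_conj' w
  rw [hz1] at ez
  rw [hw1] at ew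
  rw [h0, h1, map_add]
  push_cast at ez ew
  linear_combination (-w) * ez - z * ew

lemma isCompact_Gam : IsCompact Gam := by
  refine Metric.isCompact_of_isClosed_isBounded isClosed_closure ?_
  refine (Metric.isBounded_closedBall (x := 0) (r := 2)).subset fun x hx => ?_
  rw [mem_closedBall_zero_iff, pi_norm_le_iff_of_nonneg zero_le_two]
  intro i
  fin_cases i
  exacts [norm_zero_le_of_mem_Gam hx, (norm_one_le_of_mem_Gam hx).trans one_le_two]

lemma zero_mem_symmetrizedBidisc : (0 : Fin 2 → ℂ) ∈ symmetrizedBidisc :=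
  mem_symmetrizedBidisc_of_norm_lt (by simp)

/-- By the maximum modulus principle; it supplies `bΓ ⊆ ∂Γ`. -/
lemma isBoundaryFor_frontier_Gam : IsBoundaryFor Gam (frontier Gam) := by
  have hcl : IsClosed Gam := isClosed_closure
  refine ⟨isClosed_frontier, hcl.frontier_subset, fun p q hq => ?_⟩
  have hcont : ∀ p : MvPolynomial (Fin 2) ℂ, Differentiable ℂ fun x => eval x p := fun p => by
    induction p using MvPolynomial.induction_on with
    | C a => simp
    | add p q hp hq => simp only [map_add]; exact hp.fun_add hq
    | mul_X p n hp => 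
      simp only [map_mul, MvPolynomial.eval_X]; exact hp.fun_mul (differentiable_apply n)
  have hf : DifferentiableOn ℂ (fun x => eval x p / eval x q) Gam := by
    simp only [div_eq_mul_inv]
    exact (hcont p).differentiableOn.fun_mul ((hcont q).differentiableOn.fun_inv hq)
  obtain ⟨m, hm, hmax⟩ := isCompact_Gam.exists_isMaxOn
    ⟨0, subset_closure zero_mem_symmetrizedBidisc⟩ hf.continuousOn.norm
  by_cases hmi : m ∈ interior Gam
  · have hcs : closure (interior Gam) ⊆ Gam := closure_minimal interior_subset hcl
    obtain ⟨c, hc, hcmax⟩ := Complex.exists_mem_frontier_isMaxOn_norm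
      (isCompact_Gam.isBounded.subset interior_subset) ⟨m, hmi⟩
      (f := fun x => eval x p / eval x q)
      ⟨hf.mono interior_subset, hf.continuousOn.mono hcs⟩
    refine ⟨c, ?_, fun x hx => (hmax hx).trans (hcmax (subset_closure hmi))⟩
    rw [hcl.frontier_eq]
    rw [isOpen_interior.frontier_eq] at hc
    exact ⟨hcs hc.1, hc.2⟩
  · exact ⟨m, by rw [hcl.frontier_eq]; exact ⟨hm, hmi⟩, fun x hx => hmax hx⟩

/-- A peaking argument: on `Γ`, `|F|` reaches `1` only on the fibre over `x 1`, and within that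
fibre `|G|` reaches `1` only at `x`. Maximum points in `K` of `G F ^ N` therefore accumulate at `x`
as `N` grows. -/
lemma mem_distinguishedBoundary_Gam {x : Fin 2 → ℂ} (hx : x ∈ Gam) (h : ‖x 1‖ = 1) :
    x ∈ distinguishedBoundary Gam := by
  rintro K ⟨hK, hKG, hKmax⟩
  obtain ⟨c, hc⟩ := IsAlgClosed.exists_pow_nat_eq (x 1) (n := 2) (by norm_num)
  have hc1 : ‖c‖ = 1 := by
    have : ‖c‖ ^ 2 = 1 := by rw [← norm_pow, hc, h]
    exact (pow_eq_one_iff_of_nonneg (norm_nonneg _) two_ne_zero).1 this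
  have hcc : c * conj c = 1 := by rw [Complex.mul_conj', hc1]; simp
  have hxx : x 1 * conj (x 1) = 1 := by rw [Complex.mul_conj', h]; simp
  -- on the fibre over `x 1`, the number `conj c * s` is real
  have hreal : ∀ y ∈ Gam, y 1 = x 1 → ∃ r : ℝ, conj c * y 0 = r := fun y hy hyx => by
    have e := eq_conj_mul_of_mem_Gam hy (by rw [hyx, h])
    have : conj (conj c * y 0) = conj c * y 0 := by
      rw [map_mul, Complex.conj_conj]
      rw [hyx, ← hc] at e
      conv_rhs => rw [e]
      linear_combination (-conj (y 0) * c) * hcc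
    exact ⟨_, (Complex.conj_eq_iff_re.1 this).symm⟩
  -- As `|y 0 - x 0| ≤ 4` on `Γ`, the factor `1 / 16` gives `|G| ≤ 2` on `Γ` and `0 ≤ G ≤ 1` on the
  -- fibre, where the squared number is real.
  let G : MvPolynomial (Fin 2) ℂ := 1 - C (1 / 16) * (C (conj c) * (X 0 - C (x 0))) ^ 2
  let F : MvPolynomial (Fin 2) ℂ := C (1 / 2) * (1 + C (conj (x 1)) * X 1)
  have hG : ∀ y, eval y G = 1 - 1 / 16 * (conj c * (y 0 - x 0)) ^ 2 := fun y => by simp [G]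
  have hF : ∀ y, eval y F = 1 / 2 * (1 + conj (x 1) * y 1) := fun y => by simp [F]
  have hGx : eval x G = 1 := by simp [hG]
  have hFx : eval x F = 1 := by rw [hF, mul_comm (conj (x 1)), hxx]; norm_num
  have hGle : ∀ y ∈ Gam, ‖eval y G‖ ≤ 2 := fun y hy => by
    rw [hG]
    refine (norm_sub_le _ _).trans ?_
    have : ‖y 0 - x 0‖ ≤ 4 := (norm_sub_le _ _).trans
      (by linarith [norm_zero_le_of_mem_Gam hy, norm_zero_le_of_mem_Gam hx])
    rw [norm_mul, norm_pow, norm_mul, RCLike.norm_conj, hc1]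
    norm_num
    nlinarith [norm_nonneg (y 0 - x 0)]
  have hFle : ∀ y ∈ Gam, ‖eval y F‖ ≤ 1 := fun y hy => by
    rw [hF, norm_mul]
    have : ‖1 + conj (x 1) * y 1‖ ≤ 2 := (norm_add_le _ _).trans <| by
      rw [norm_mul, RCLike.norm_conj, h, norm_one]
      linarith [norm_one_le_of_mem_Gam hy]
    norm_num
    linarith
  have hmax : ∀ N : ℕ, ∃ k ∈ K, 1 ≤ ‖eval k G‖ * ‖eval k F‖ ^ N := fun N => by
    obtain ⟨k, hk, hkm⟩ := hKmax (G * F ^ N) 1 (fun y _ => by simp)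
    refine ⟨k, hk, ?_⟩
    simpa [hGx, hFx] using hkm x hx
  choose k hk hkN using hmax
  obtain ⟨y, hy, φ, hφ, hlim⟩ := (isCompact_Gam.of_isClosed_subset hK hKG).tendsto_subseq hk
  have hyG := hKG hy
  have hcG : Filter.Tendsto (fun n => ‖eval (k (φ n)) G‖) Filter.atTop (𝓝 ‖eval y G‖) :=
    ((MvPolynomial.continuous_eval G).norm.tendsto y).comp hlim
  have hcF : Filter.Tendsto (fun n => ‖eval (k (φ n)) F‖) Filter.atTop (𝓝 ‖eval y F‖) :=
    ((MvPolynomial.continuous_eval F).norm.tendsto y).comp hlim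
  have hy1 : 1 ≤ ‖eval y G‖ := ge_of_tendsto' hcG fun n =>
    (hkN (φ n)).trans (mul_le_of_le_one_right (norm_nonneg _)
      (pow_le_one₀ (norm_nonneg _) (hFle _ (hKG (hk _)))))
  have hy2 : 1 ≤ ‖eval y F‖ := by
    by_contra! hlt
    obtain ⟨r, hr1, hr2⟩ := exists_between hlt
    have hr0 : 0 ≤ r := (norm_nonneg _).trans hr1.le
    have h2 : Filter.Tendsto (fun n => 2 * r ^ φ n) Filter.atTop (𝓝 (2 * 0)) :=
      ((tendsto_pow_atTop_nhds_zero_of_lt_one hr0 hr2).comp hφ.tendsto_atTop).const_mul 2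
    rw [mul_zero] at h2
    obtain ⟨n, hn1, hn2⟩ := ((hcF.eventually_lt_const hr1).and
      (h2.eventually_lt_const one_pos)).exists
    have := hkN (φ n)
    have h3 : ‖eval (k (φ n)) G‖ * ‖eval (k (φ n)) F‖ ^ φ n ≤ 2 * r ^ φ n :=
      mul_le_mul (hGle _ (hKG (hk _))) (pow_le_pow_left₀ (norm_nonneg _) hn1.le _)
        (by positivity) zero_le_two
    linarith
  have hyp : y 1 = x 1 := by
    have hle := norm_one_le_of_mem_Gam hyG
    have hu : ‖conj (x 1) * y 1‖ ≤ 1 := by rwa [norm_mul, RCLike.norm_conj, h, one_mul]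
    rw [hF, norm_mul] at hy2
    norm_num at hy2
    have h2 : 2 ≤ ‖1 + conj (x 1) * y 1‖ := by linarith
    generalize hU : conj (x 1) * y 1 = u at hu h2
    have hu1 : u = 1 := by
      have a1 := Complex.sq_norm (1 + u)
      have a2 := Complex.sq_norm u
      simp only [Complex.normSq_apply, Complex.add_re, Complex.add_im, Complex.one_re,
        Complex.one_im] at a1 a2
      have b1 : u.re = 1 := by nlinarith [norm_nonneg u]
      refine Complex.ext b1 ?_
      rw [Complex.one_im]
      rw [b1] at a2
      nlinarith [norm_nonneg u]
    linear_combination x 1 * (hU.trans hu1) - y 1 * hxx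
  have hys : y 0 = x 0 := by
    obtain ⟨r, hr⟩ := hreal y hyG hyp
    obtain ⟨t, ht⟩ := hreal x hx rfl
    have hn : ∀ z ∈ Gam, ‖conj c * z 0‖ ≤ 2 := fun z hz => by
      rw [norm_mul, RCLike.norm_conj, hc1, one_mul]
      exact norm_zero_le_of_mem_Gam hz
    have hr2 := hn y hyG
    have ht2 := hn x hx
    rw [hr, Complex.norm_real, Real.norm_eq_abs, abs_le] at hr2
    rw [ht, Complex.norm_real, Real.norm_eq_abs, abs_le] at ht2
    rw [hG, mul_sub, hr, ht, show (1 - 1 / 16 * ((r : ℂ) - t) ^ 2) =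
      ((1 - 1 / 16 * (r - t) ^ 2 : ℝ) : ℂ) by push_cast; rfl, Complex.norm_real,
      Real.norm_of_nonneg (by nlinarith)] at hy1
    have hrt : r = t := by
      have : (r - t) ^ 2 = 0 := le_antisymm (by linarith) (sq_nonneg _)
      exact sub_eq_zero.1 (pow_eq_zero_iff two_ne_zero |>.1 this)
    rw [hrt, ← ht] at hr
    exact mul_left_cancel₀ (left_ne_zero_of_mul_eq_one (by rwa [mul_comm] at hcc)) hr
  have : y = x := by
    ext i
    fin_cases i
    exacts [hys, hyp]
  exact this ▸ hy

/-! ### A criterion for distinguished polynomials -/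

/-- All zeros of `q` in the open strip `|z₂| < 1` lie in the symmetrized bidisc. -/
def StripZerosInBidisc (q : MvPolynomial (Fin 2) ℂ) : Prop :=
  ∀ x : Fin 2 → ℂ, eval x q = 0 → ‖x 1‖ < 1 → x ∈ symmetrizedBidisc

/-- The open set `𝔾₂` misses `∂Γ`, so a zero on `∂Γ` must have `|z₂| = 1`. Unlike the definition,
this criterion passes to products at once. -/
lemma StripZerosInBidisc.isGammaDistinguishedPoly {q : MvPolynomial (Fin 2) ℂ}
    (hq : StripZerosInBidisc q) (hne : (zeroSet q ∩ symmetrizedBidisc).Nonempty) :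
    IsGammaDistinguishedPoly q := by
  refine ⟨hne, Set.Subset.antisymm (fun x hx => ⟨hx.1, ?_⟩)
    (fun x hx => ⟨hx.1, hx.2 _ isBoundaryFor_frontier_Gam⟩)⟩
  have hxG : x ∈ Gam := isClosed_closure.frontier_subset hx.2
  refine mem_distinguishedBoundary_Gam hxG ?_
  refine le_antisymm (norm_one_le_of_mem_Gam hxG) ?_
  by_contra! hlt
  exact hx.2.2 (interior_maximal subset_closure isOpen_symmetrizedBidisc (hq x hx.1 hlt))

lemma StripZerosInBidisc.mul {p q : MvPolynomial (Fin 2) ℂ} (hp : StripZerosInBidisc p)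
    (hq : StripZerosInBidisc q) : StripZerosInBidisc (p * q) := fun x hx h => by
  rw [map_mul, mul_eq_zero] at hx
  exact hx.elim (fun hx => hp x hx h) fun hx => hq x hx h

lemma stripZerosInBidisc_multiset_prod {m : Multiset (MvPolynomial (Fin 2) ℂ)}
    (hm : ∀ q ∈ m, StripZerosInBidisc q) : StripZerosInBidisc m.prod := by
  induction m using Multiset.induction with
  | empty => exact fun x hx => by simp at hx
  | cons q m ih =>
    rw [Multiset.prod_cons]
    exact (hm q (Multiset.mem_cons_self _ _)).mul
      (ih fun r hr => hm r (Multiset.mem_cons_of_mem hr))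

lemma stripZerosInBidisc_X : StripZerosInBidisc (X 0) := fun x hx h => by
  rw [MvPolynomial.eval_X] at hx
  exact mem_symmetrizedBidisc_of_eq (a := 0) (by simp) h (by simp [hx])

lemma stripZerosInBidisc_sq_sub {t : ℝ} (h0 : 0 ≤ t) (h4 : t ≤ 4) :
    StripZerosInBidisc (X 0 ^ 2 - C (t : ℂ) * X 1) := fun x hx h => by
  refine mem_symmetrizedBidisc_of_norm_lt ?_
  have hx' : x 0 ^ 2 = t * x 1 := by
    simpa [sub_eq_zero] using hx
  have hn : ‖x 0‖ ^ 2 = t * ‖x 1‖ := by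
    rw [← norm_pow, hx', norm_mul, Complex.norm_real, Real.norm_of_nonneg h0]
  have hp := norm_nonneg (x 1)
  -- To be compared with `(1 - |p|²)² = (1 + |p|)²(1 - |p|)²`; here `t ≤ 4` enters through `4|p| <
  -- (1 + |p|)²`.
  have e : ‖x 0 - conj (x 0) * x 1‖ ^ 2 = t * ‖x 1‖ * (1 - ‖x 1‖) ^ 2 := by
    have e1 : ((‖x 0 - conj (x 0) * x 1‖ ^ 2 : ℝ) : ℂ) =
        ((‖x 0‖ ^ 2 * (1 + ‖x 1‖ ^ 2) - 2 * t * ‖x 1‖ ^ 2 : ℝ) : ℂ) := by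
      push_cast
      have hxc : conj (x 0) ^ 2 = t * conj (x 1) := by
        rw [← map_pow, hx', map_mul, Complex.conj_ofReal]
      rw [← Complex.mul_conj', ← Complex.mul_conj' (x 0), ← Complex.mul_conj' (x 1)]
      simp only [map_sub, map_mul, Complex.conj_conj]
      linear_combination (-conj (x 1)) * hx' - x 1 * hxc
    have e2 := Complex.ofReal_injective e1
    rw [e2, hn]
    ring
  have h1 : 0 < 1 - ‖x 1‖ := by linarith
  refine (sq_lt_sq₀ (norm_nonneg _) (by nlinarith)).1 ?_
  rw [e]
  have : t * ‖x 1‖ < (1 + ‖x 1‖) ^ 2 := by nlinarith [mul_pos h1 h1]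
  calc _ < (1 + ‖x 1‖) ^ 2 * (1 - ‖x 1‖) ^ 2 := by gcongr
    _ = _ := by ring


/-! ### Polynomial calculus of a commuting pair and the determinantal pencil. -/

section PolynomialCalculus

variable {H : Type*} [NormedAddCommGroup H] [InnerProductSpace ℂ H]

/-- The evaluation `p ↦ p(S, P)` at a commuting pair, as an algebra homomorphism. -/
def polyEvalHom {S P : H →L[ℂ] H} (h : Commute S P) :
    MvPolynomial (Fin 2) ℂ →ₐ[ℂ] (H →L[ℂ] H) :=
  AddMonoidAlgebra.lift ℂ (H →L[ℂ] H) (Fin 2 →₀ ℕ)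
    { toFun := fun m => S ^ (m.toAdd 0) * P ^ (m.toAdd 1)
      map_one' := by simp
      map_mul' := fun m n => by
        simp only [toAdd_mul, Finsupp.add_apply, pow_add]
        rw [mul_assoc, mul_assoc, ← mul_assoc (S ^ (n.toAdd 0)),
          (h.pow_pow (n.toAdd 0) (m.toAdd 1)).eq]
        simp only [mul_assoc] }

lemma polyEval_eq {S P : H →L[ℂ] H} (h : Commute S P) (p : MvPolynomial (Fin 2) ℂ) :
    polyEval p S P = polyEvalHom h p := by
  rw [polyEvalHom, AddMonoidAlgebra.lift_apply, MvPolynomial.sum_def]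
  rfl

lemma polyEvalHom_X_zero {S P : H →L[ℂ] H} (h : Commute S P) : polyEvalHom h (X 0) = S := by
  rw [polyEvalHom, X, MvPolynomial.monomial]
  simp

lemma polyEvalHom_X_one {S P : H →L[ℂ] H} (h : Commute S P) : polyEvalHom h (X 1) = P := by
  rw [polyEvalHom, X, MvPolynomial.monomial]
  simp

lemma polyEvalHom_C {S P : H →L[ℂ] H} (h : Commute S P) (a : ℂ) :
    polyEvalHom h (C a) = a • 1 := by
  rw [← MvPolynomial.algebraMap_eq, AlgHom.commutes, Algebra.algebraMap_eq_smul_one]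

lemma polyEvalHom_mem {S P : H →L[ℂ] H} (h : Commute S P) {K : Submodule ℂ H}
    (hS : ∀ x ∈ K, S x ∈ K) (hP : ∀ x ∈ K, P x ∈ K) (q : MvPolynomial (Fin 2) ℂ) :
    ∀ x ∈ K, polyEvalHom h q x ∈ K := by
  induction q using MvPolynomial.induction_on with
  | C a => exact fun x hx => by simpa [polyEvalHom_C] using K.smul_mem a hx
  | add p q hp hq => exact fun x hx => by simpa using K.add_mem (hp x hx) (hq x hx)
  | mul_X p n hp =>
    intro x hx
    rw [map_mul, mul_apply_eq_comp]
    refine hp _ ?_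
    fin_cases n
    · simpa [polyEvalHom_X_zero] using hS x hx
    · simpa [polyEvalHom_X_one] using hP x hx

/-- The determinant trick: if a matrix `M` over a commutative ring acting on `H` annihilates a
vector of functionals, then so does `det M`. -/
lemma apply_det_eq_zero {R n : Type*} [CommRing R] [Fintype n] [DecidableEq n]
    (ev : R →+* (H →L[ℂ] H)) (M : Matrix n n R) (d : n → H →ₗ[ℂ] ℂ)
    (hM : ∀ i h, ∑ j, d j (ev (M i j) h) = 0) (k : n) (h : H) : d k (ev M.det h) = 0 := by
  -- Row `k` of `adj M * M = det M`; the hypothesis is then used at the vectors `ev (adj M k i) h`.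
  have e : ∀ j, ∑ i, M.adjugate k i * M i j = if k = j then M.det else 0 := fun j => by
    rw [← Matrix.mul_apply, Matrix.adjugate_mul, Matrix.smul_apply, Matrix.one_apply]
    simp
  have h1 : d k (ev M.det h) = ∑ j, d j (ev (∑ i, M.adjugate k i * M i j) h) := by
    simp only [e]
    rw [Finset.sum_eq_single k]
    · simp
    · intro j _ hj
      simp [hj.symm]
    · simp
  have h2 : ∀ j, d j (ev (∑ i, M.adjugate k i * M i j) h) =
      ∑ i, d j (ev (M i j) (ev (M.adjugate k i) h)) := fun j => by
    rw [map_sum, sum_apply, map_sum]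
    refine Finset.sum_congr rfl fun i _ => ?_
    rw [mul_comm, map_mul, mul_apply_eq_comp]
  simp only [h1, h2]
  rw [Finset.sum_comm]
  exact Finset.sum_eq_zero fun i _ => hM i _

lemma norm_inner_lt_one_of_numericalRadius_lt {A : H →L[ℂ] H} (h : numericalRadius A < 1) {v : H}
    (hv : ‖v‖ = 1) : ‖⟪v, A v⟫_ℂ‖ < 1 := by
  refine lt_of_le_of_lt ?_ h
  rw [norm_inner_symm]
  refine le_csSup ⟨‖A‖, ?_⟩ ⟨v, hv, rfl⟩
  rintro _ ⟨x, hx, rfl⟩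
  calc ‖⟪A x, x⟫_ℂ‖ ≤ ‖A x‖ * ‖x‖ := norm_inner_le_norm _ _
    _ ≤ ‖A‖ * ‖x‖ * ‖x‖ := by gcongr; exact A.le_opNorm x
    _ = ‖A‖ := by rw [hx]; ring

variable [CompleteSpace H] [FiniteDimensional ℂ H]

lemma eval_pencilPoly (A : H →L[ℂ] H) (x : Fin 2 → ℂ) :
    eval x (pencilPoly A) =
      LinearMap.det (A.toLinearMap + x 1 • (star A).toLinearMap - x 0 • LinearMap.id) := by
  rw [pencilPoly, RingHom.map_det, ← LinearMap.det_toMatrix (Module.finBasis ℂ H)]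
  congr 1
  ext i j
  by_cases hij : i = j <;> simp [hij]

lemma exists_eigenvector_of_eval_pencilPoly (A : H →L[ℂ] H) {x : Fin 2 → ℂ}
    (hx : eval x (pencilPoly A) = 0) : ∃ v : H, ‖v‖ = 1 ∧ A v + x 1 • star A v = x 0 • v := by
  rw [eval_pencilPoly] at hx
  obtain ⟨v, hv, hv0⟩ := (Submodule.ne_bot_iff _).1 (LinearMap.bot_lt_ker_of_det_eq_zero hx).ne'
  refine ⟨(‖v‖ : ℂ)⁻¹ • v, norm_smul_inv_norm hv0, ?_⟩
  have : A v + x 1 • star A v = x 0 • v := by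
    simpa [sub_eq_zero] using hv
  rw [map_smul, map_smul, smul_comm (x 1), ← smul_add, this, smul_comm]

lemma stripZerosInBidisc_pencilPoly {A : H →L[ℂ] H} (h : numericalRadius A < 1) :
    StripZerosInBidisc (pencilPoly A) := fun x hx hx1 => by
  obtain ⟨v, hv, e⟩ := exists_eigenvector_of_eval_pencilPoly A hx
  refine mem_symmetrizedBidisc_of_eq (norm_inner_lt_one_of_numericalRadius_lt h hv) hx1 ?_
  have := congrArg (fun w => ⟪v, w⟫_ℂ) e
  simp only [inner_add_right, inner_smul_right, inner_self_eq_norm_sq_to_K, hv,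
    ContinuousLinearMap.star_eq_adjoint, ContinuousLinearMap.adjoint_inner_right] at this
  rw [inner_conj_symm, mul_comm, this]
  simp

lemma zeroSet_pencilPoly_inter_nonempty [Nontrivial H] {A : H →L[ℂ] H}
    (h : numericalRadius A < 1) : (zeroSet (pencilPoly A) ∩ symmetrizedBidisc).Nonempty := by
  obtain ⟨s, hs⟩ := Module.End.exists_eigenvalue A.toLinearMap
  obtain ⟨v, hv⟩ := hs.exists_hasEigenvector
  -- On the line `z₂ = 0` the pencil is the characteristic determinant of `A`.
  have h0 : eval ![s, 0] (pencilPoly A) = 0 := by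
    rw [eval_pencilPoly]
    by_contra hdet
    have hu : IsUnit (A.toLinearMap + (![s, 0] : Fin 2 → ℂ) 1 • (star A).toLinearMap -
        (![s, 0] : Fin 2 → ℂ) 0 • LinearMap.id) :=
      (LinearMap.isUnit_iff_isUnit_det _).2 (isUnit_iff_ne_zero.2 hdet)
    refine hv.2 ((Module.End.isUnit_iff _).1 hu |>.1 ?_)
    simpa [sub_eq_zero] using hv.apply_eq_smul
  exact ⟨_, h0, stripZerosInBidisc_pencilPoly h _ h0 (by simp)⟩

/-- `hT` says that the matrix of the pencil, evaluated at `(S, P)`, annihilates the coordinate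
functionals of `T`, so its determinant does too. It is applied with `T = D_P`. -/
lemma apply_pencilPoly_eq_zero {K : Type*} [NormedAddCommGroup K] [InnerProductSpace ℂ K]
    {S P : K →L[ℂ] K} (hc : Commute S P) (A : H →L[ℂ] H) (T : K →ₗ[ℂ] H)
    (hT : ∀ h, T (S h) = A (T h) + star A (T (P h))) (h : K) :
    T (polyEvalHom hc (pencilPoly A) h) = 0 := by
  let b := Module.finBasis ℂ H
  refine b.ext_elem fun k => ?_
  rw [map_zero, Finsupp.zero_apply]
  refine apply_det_eq_zero (polyEvalHom hc).toRingHom _ (fun i => b.coord i ∘ₗ T) ?_ k h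
  intro i h
  have hA : ∀ (B : H →L[ℂ] H) v, ∑ j, LinearMap.toMatrix b b B.toLinearMap i j * b.repr v j =
      b.repr (B v) i := fun B v => congrFun (LinearMap.toMatrix_mulVec_repr b b B.toLinearMap v) i
  have e : ∀ j, (b.coord j ∘ₗ T) ((polyEvalHom hc).toRingHom
      (((LinearMap.toMatrix b b A.toLinearMap).map (fun c => (C c : MvPolynomial (Fin 2) ℂ)) +
      (X 1 : MvPolynomial (Fin 2) ℂ) • (LinearMap.toMatrix b b (star A).toLinearMap).map
        (fun c => (C c : MvPolynomial (Fin 2) ℂ)) - (X 0 : MvPolynomial (Fin 2) ℂ) • 1) i j) h) =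
      LinearMap.toMatrix b b A.toLinearMap i j * b.repr (T h) j +
      LinearMap.toMatrix b b (star A).toLinearMap i j * b.repr (T (P h)) j -
      if i = j then b.repr (T (S h)) j else 0 := fun j => by
    by_cases hij : i = j <;>
    simp [hij, polyEvalHom_X_one, polyEvalHom_X_zero]
  rw [Finset.sum_congr rfl fun j _ => e j, Finset.sum_sub_distrib, Finset.sum_add_distrib, hA, hA,
    hT]
  simp

end PolynomialCalculus


/-! ### Γ-contractions, defect operators and unimodular eigenvectors. -/

section GammaContraction

variable {H : Type*} [NormedAddCommGroup H] [InnerProductSpace ℂ H]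

lemma IsGammaContraction.norm_polyEvalHom_le {S P : H →L[ℂ] H} (h : IsGammaContraction S P)
    (p : MvPolynomial (Fin 2) ℂ) {r : ℝ} (hr : 0 ≤ r) (hp : ∀ x ∈ Gam, ‖eval x p‖ ≤ r) :
    ‖polyEvalHom h.1 p‖ ≤ r := by
  have := h.2.2 p 1 (fun x _ => by simp)
  rw [polyEval_eq h.1, polyEval_eq h.1, map_one, Ring.inverse_one, mul_one] at this
  refine this.trans (Real.sSup_le ?_ hr)
  rintro _ ⟨x, hx, rfl⟩
  simpa using hp x hx

lemma IsGammaContraction.norm_fst_le {S P : H →L[ℂ] H} (h : IsGammaContraction S P) :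
    ‖S‖ ≤ 2 := by
  simpa [polyEvalHom_X_zero] using h.norm_polyEvalHom_le (X 0) zero_le_two
    fun x hx => by simpa using norm_zero_le_of_mem_Gam hx

lemma IsGammaContraction.norm_snd_le {S P : H →L[ℂ] H} (h : IsGammaContraction S P) :
    ‖P‖ ≤ 1 := by
  simpa [polyEvalHom_X_one] using h.norm_polyEvalHom_le (X 1) zero_le_one
    fun x hx => by simpa using norm_one_le_of_mem_Gam hx

/-- The span of the eigenvectors of `P` with unimodular eigenvalue. -/
def unimodularEigenspan (P : H →L[ℂ] H) : Submodule ℂ H :=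
  Submodule.span ℂ {v | ∃ μ : ℂ, ‖μ‖ = 1 ∧ P v = μ • v}

lemma mem_orthogonal_unimodularEigenspan {P : H →L[ℂ] H} {h : H} :
    h ∈ (unimodularEigenspan P)ᗮ ↔
      ∀ (μ : ℂ) (v : H), ‖μ‖ = 1 → P v = μ • v → ⟪v, h⟫_ℂ = 0 := by
  refine ⟨fun hh μ v hμ hv =>
    Submodule.inner_right_of_mem_orthogonal (K := unimodularEigenspan P)
      (Submodule.subset_span ⟨μ, hμ, hv⟩) hh,
    fun hh => (Submodule.mem_orthogonal _ _).2 fun u hu => ?_⟩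
  induction hu using Submodule.span_induction with
  | mem x hx =>
    obtain ⟨μ, hμ, hx⟩ := hx
    exact hh μ x hμ hx
  | zero => exact inner_zero_left _
  | add x y _ _ hx hy => rw [inner_add_left, hx, hy, add_zero]
  | smul a x _ hx => rw [inner_smul_left, hx, mul_zero]

variable [CompleteSpace H]

lemma defectOp_mul_self {P : H →L[ℂ] H} (hP : ‖P‖ ≤ 1) :
    defectOp P * defectOp P = 1 - star P * P := by
  refine CFC.sqrt_mul_sqrt_self _ ?_
  rw [ContinuousLinearMap.nonneg_iff_isPositive, ContinuousLinearMap.isPositive_iff']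
  refine ⟨by simp [IsSelfAdjoint], fun x => ?_⟩
  have e : ⟪(1 - star P * P) x, x⟫_ℂ = ((‖x‖ ^ 2 - ‖P x‖ ^ 2 : ℝ) : ℂ) := by
    simp [ContinuousLinearMap.star_eq_adjoint, ContinuousLinearMap.adjoint_inner_left, inner_self_eq_norm_sq_to_K]
  rw [e]
  have : ‖P x‖ ≤ ‖x‖ := (P.le_of_opNorm_le hP x).trans_eq (one_mul _)
  exact_mod_cast sub_nonneg.2 (pow_le_pow_left₀ (norm_nonneg _) this 2)

lemma inner_defectOp_left (P : H →L[ℂ] H) (x y : H) :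
    ⟪defectOp P x, y⟫_ℂ = ⟪x, defectOp P y⟫_ℂ := by
  have h : star (defectOp P) = defectOp P := (CFC.sqrt_nonneg (1 - star P * P)).isSelfAdjoint
  rw [← ContinuousLinearMap.adjoint_inner_right, ← ContinuousLinearMap.star_eq_adjoint, h]

lemma norm_defectOp_sq {P : H →L[ℂ] H} (hP : ‖P‖ ≤ 1) (x : H) :
    ‖defectOp P x‖ ^ 2 = ‖x‖ ^ 2 - ‖P x‖ ^ 2 := by
  have h : ⟪defectOp P x, defectOp P x⟫_ℂ = ⟪x, x⟫_ℂ - ⟪P x, P x⟫_ℂ := by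
    rw [inner_defectOp_left, ← mul_apply_eq_comp, defectOp_mul_self hP]
    simp [ContinuousLinearMap.star_eq_adjoint, ContinuousLinearMap.adjoint_inner_right]
  simp only [inner_self_eq_norm_sq_to_K] at h
  exact_mod_cast h

lemma defectOp_eq_zero_iff {P : H →L[ℂ] H} (hP : ‖P‖ ≤ 1) (x : H) :
    defectOp P x = 0 ↔ ‖P x‖ = ‖x‖ := by
  rw [← norm_eq_zero, ← sq_eq_zero_iff, norm_defectOp_sq hP, sub_eq_zero,
    sq_eq_sq₀ (norm_nonneg _) (norm_nonneg _), eq_comm]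

/-- `D_P` as a linear map into `𝒟_P`. -/
def defectMap (P : H →L[ℂ] H) : H →ₗ[ℂ] defectSpace P where
  toFun := toDefectSpace P
  map_add' x y := Subtype.ext (map_add (defectOp P) x y)
  map_smul' c x := Subtype.ext (map_smul (defectOp P) c x)

lemma coe_defectMap (P : H →L[ℂ] H) (x : H) : (defectMap P x : H) = defectOp P x := rfl

lemma eq_zero_of_defectOp_eq_zero {P : H →L[ℂ] H} (w : defectSpace P)
    (hw : defectOp P w = 0) : w = 0 := by
  have h1 : (w : H) ∈ (LinearMap.range (defectOp P).toLinearMap)ᗮ := by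
    rw [Submodule.mem_orthogonal]
    rintro _ ⟨k, rfl⟩
    rw [ContinuousLinearMap.coe_coe, inner_defectOp_left, hw, inner_zero_right]
  rw [← Submodule.orthogonal_closure] at h1
  exact Subtype.ext (inner_self_eq_zero.1 (Submodule.inner_right_of_mem_orthogonal w.2 h1))

/-- `D_P` is injective on `𝒟_P`, so the identity may be checked after applying it. The left side
becomes `(1 - P*P)S`, the right side `(S - S*P) + (S* - P*S)P`, and these agree because `SP = PS`.
-/
lemma IsFundamentalOperator.defectMap_fst {S P : H →L[ℂ] H}
    {A : defectSpace P →L[ℂ] defectSpace P} (hA : IsFundamentalOperator S P A)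
    (hc : Commute S P) (hP : ‖P‖ ≤ 1) (h : H) :
    defectMap P (S h) = A (defectMap P h) + star A (defectMap P (P h)) := by
  have hadj : ∀ g, defectOp P (star A (defectMap P g)) = (star S - star P * S) g := fun g => by
    refine ext_inner_left ℂ fun k => ?_
    calc ⟪k, defectOp P (star A (defectMap P g))⟫_ℂ
        = ⟪defectMap P k, star A (defectMap P g)⟫_ℂ := (inner_defectOp_left P k _).symm
      _ = ⟪A (defectMap P k), defectMap P g⟫_ℂ := by
        rw [ContinuousLinearMap.star_eq_adjoint, ContinuousLinearMap.adjoint_inner_right]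
      _ = ⟪defectOp P (A (defectMap P k)), g⟫_ℂ := (inner_defectOp_left P _ g).symm
      _ = ⟪(S - star S * P) k, g⟫_ℂ := by rw [hA.2 k]; rfl
      _ = ⟪k, (star S - star P * S) g⟫_ℂ := by
        simp [ContinuousLinearMap.star_eq_adjoint, ContinuousLinearMap.adjoint_inner_left, ContinuousLinearMap.adjoint_inner_right]
  rw [← sub_eq_zero]
  refine eq_zero_of_defectOp_eq_zero _ ?_
  have h1 : defectOp P (A (defectMap P h)) = (S - star S * P) h := (hA.2 h).symm
  have h2 : defectOp P (defectMap P (S h)) = (1 - star P * P) (S h) := by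
    rw [← defectOp_mul_self hP]; rfl
  have h3 : S (P h) = P (S h) := DFunLike.congr_fun hc.eq h
  rw [Submodule.coe_sub, Submodule.coe_add, map_sub, map_add, h1, h2, hadj]
  simp [h3]

lemma star_apply_of_apply_eq_smul {P : H →L[ℂ] H} (hP : ‖P‖ ≤ 1) {μ : ℂ} (hμ : ‖μ‖ = 1) {v : H}
    (hv : P v = μ • v) : star P v = conj μ • v := by
  have h : ‖P v‖ = ‖v‖ := by rw [hv, norm_smul, hμ, one_mul]
  have h0 := (defectOp_eq_zero_iff hP v).2 h
  have h1 : (1 - star P * P) v = 0 := by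
    rw [← defectOp_mul_self hP, mul_apply_eq_comp, h0, map_zero]
  have h2 : v = μ • star P v := by
    simpa [sub_eq_zero, hv] using h1
  have h3 : conj μ * μ = 1 := by rw [Complex.conj_mul', hμ]; simp
  conv_rhs => rw [h2, smul_smul, h3, one_smul]

lemma snd_mem_orthogonal {P : H →L[ℂ] H} (hP : ‖P‖ ≤ 1) :
    ∀ h ∈ (unimodularEigenspan P)ᗮ, P h ∈ (unimodularEigenspan P)ᗮ := fun h hh => by
  rw [mem_orthogonal_unimodularEigenspan] at hh ⊢
  intro μ v hμ hv
  rw [← ContinuousLinearMap.adjoint_inner_left, ← ContinuousLinearMap.star_eq_adjoint,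
    star_apply_of_apply_eq_smul hP hμ hv, inner_smul_left, hh μ v hμ hv, mul_zero]

/-! ### Annihilation on the unimodular eigenspan and on its orthogonal complement. -/

section FundamentalOperator

variable {S P : H →L[ℂ] H} {A : defectSpace P →L[ℂ] defectSpace P}

lemma IsFundamentalOperator.fst_apply (hA : IsFundamentalOperator S P A) (hP : ‖P‖ ≤ 1) {μ : ℂ}
    (hμ : ‖μ‖ = 1) {v : H} (hv : P v = μ • v) : S v = μ • star S v := by
  have h0 : toDefectSpace P v = 0 := Subtype.ext <|
    (defectOp_eq_zero_iff hP v).2 (by rw [hv, norm_smul, hμ, one_mul])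
  have := hA.2 v
  rw [h0] at this
  simpa [hv, sub_eq_zero] using this

/-- `S` preserves the eigenspace of `μ` and equals `μS*` there, so `S*` preserves it as well; this
makes the orthogonal complement of the eigenspan invariant under `S`. -/
lemma IsFundamentalOperator.snd_star_apply (hA : IsFundamentalOperator S P A) (hc : Commute S P)
    (hP : ‖P‖ ≤ 1) {μ : ℂ} (hμ : ‖μ‖ = 1) {v : H} (hv : P v = μ • v) :
    P (star S v) = μ • star S v := by
  have h3 : P (S v) = S (P v) := (DFunLike.congr_fun hc.eq v).symm
  have hμ0 : μ ≠ 0 := fun h => by simp [h] at hμ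
  rw [hv, map_smul, hA.fst_apply hP hμ hv, map_smul] at h3
  exact smul_right_injective H hμ0 h3

lemma IsFundamentalOperator.fst_mem_orthogonal (hA : IsFundamentalOperator S P A)
    (hc : Commute S P) (hP : ‖P‖ ≤ 1) :
    ∀ h ∈ (unimodularEigenspan P)ᗮ, S h ∈ (unimodularEigenspan P)ᗮ := fun h hh => by
  rw [mem_orthogonal_unimodularEigenspan] at hh ⊢
  intro μ v hμ hv
  rw [← ContinuousLinearMap.adjoint_inner_left, ← ContinuousLinearMap.star_eq_adjoint]
  exact hh μ _ hμ (hA.snd_star_apply hc hP hμ hv)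

variable [FiniteDimensional ℂ H]

/-- A vector on which all powers of the contraction `P` are isometric is zero if it is orthogonal
to the unimodular eigenvectors of `P`. -/
lemma eq_zero_of_defectOp_pow_eq_zero (hP : ‖P‖ ≤ 1) {h : H}
    (hh : h ∈ (unimodularEigenspan P)ᗮ) (hd : ∀ n : ℕ, defectOp P ((P ^ n) h) = 0) : h = 0 := by
  -- `N` is `P`-invariant and `P` is isometric on it, so an eigenvector in `N` would be unimodular
  -- and orthogonal to itself.
  let N : Submodule ℂ H := (unimodularEigenspan P)ᗮ ⊓
    ⨅ n : ℕ, LinearMap.ker (defectOp P ∘L (P ^ n)).toLinearMap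
  have hmem : ∀ x, x ∈ N ↔ x ∈ (unimodularEigenspan P)ᗮ ∧ ∀ n : ℕ, defectOp P ((P ^ n) x) = 0 :=
    fun x => by
      simp only [N, Submodule.mem_inf, Submodule.mem_iInf]
      rfl
  have hPN : ∀ x ∈ N, P.toLinearMap x ∈ N := fun x hx => by
    rw [hmem] at hx ⊢
    refine ⟨snd_mem_orthogonal hP x hx.1, fun n => ?_⟩
    have := hx.2 (n + 1)
    rwa [pow_succ] at this
  by_contra h0
  have : Nontrivial N := (Submodule.nontrivial_iff_ne_bot).2
    ((Submodule.ne_bot_iff _).2 ⟨h, (hmem h).2 ⟨hh, hd⟩, h0⟩)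
  obtain ⟨μ, hμ⟩ := Module.End.exists_eigenvalue (P.toLinearMap.restrict hPN)
  obtain ⟨v, hv⟩ := hμ.exists_hasEigenvector
  have hPv : P v = μ • (v : H) := congrArg Subtype.val hv.apply_eq_smul
  have hvN := (hmem v).1 v.2
  have hv0 : (v : H) ≠ 0 := fun h => hv.2 (Subtype.ext h)
  have hn : ‖P v‖ = ‖(v : H)‖ := (defectOp_eq_zero_iff hP _).1 (by simpa using hvN.2 0)
  rw [hPv, norm_smul] at hn
  have hμ1 : ‖μ‖ = 1 := mul_right_cancel₀ (norm_ne_zero_iff.2 hv0) (by rw [hn, one_mul])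
  exact hv0 (inner_self_eq_zero.1
    ((mem_orthogonal_unimodularEigenspan.1 hvN.1) μ v hμ1 hPv))

lemma IsFundamentalOperator.polyEvalHom_pencilPoly_apply (hA : IsFundamentalOperator S P A)
    (hc : Commute S P) (hP : ‖P‖ ≤ 1) {h : H} (hh : h ∈ (unimodularEigenspan P)ᗮ) :
    polyEvalHom hc (pencilPoly A) h = 0 := by
  refine eq_zero_of_defectOp_pow_eq_zero hP (polyEvalHom_mem hc (hA.fst_mem_orthogonal hc hP)
    (snd_mem_orthogonal hP) _ h hh) fun n => ?_
  have hcomm : P ^ n * polyEvalHom hc (pencilPoly A) = polyEvalHom hc (pencilPoly A) * P ^ n := by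
    have hX : P ^ n = polyEvalHom hc (X 1 ^ n) := by rw [map_pow, polyEvalHom_X_one]
    rw [hX, ← map_mul, ← map_mul, mul_comm]
  rw [← mul_apply_eq_comp (P ^ n), hcomm, mul_apply_eq_comp, ← coe_defectMap,
    apply_pencilPoly_eq_zero hc A (defectMap P) (hA.defectMap_fst hc hP), Submodule.coe_zero]

/-- The product of the polynomials `z₁² - t z₂` over the eigenvalues `t` of `S* S`. -/
def modulusPoly (S : H →L[ℂ] H) : MvPolynomial (Fin 2) ℂ :=
  ((star S * S).toLinearMap.charpoly.roots.map fun t => X 0 ^ 2 - C t * X 1).prod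

lemma stripZerosInBidisc_modulusPoly (hS : ‖S‖ ≤ 2) : StripZerosInBidisc (modulusPoly S) := by
  refine stripZerosInBidisc_multiset_prod fun q hq => ?_
  obtain ⟨t, ht, rfl⟩ := Multiset.mem_map.1 hq
  have hev : Module.End.HasEigenvalue (star S * S).toLinearMap t :=
    (Module.End.hasEigenvalue_iff_isRoot_charpoly _ _).2 (Polynomial.isRoot_of_mem_roots ht)
  obtain ⟨v, hv⟩ := hev.exists_hasEigenvector
  have hv0 : 0 < ‖v‖ := norm_pos_iff.2 hv.2
  have e : ⟪v, (star S * S) v⟫_ℂ = ⟪v, t • v⟫_ℂ := congrArg _ hv.apply_eq_smul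
  rw [mul_apply_eq_comp, ContinuousLinearMap.star_eq_adjoint,
    ContinuousLinearMap.adjoint_inner_right, inner_smul_right, inner_self_eq_norm_sq_to_K,
    inner_self_eq_norm_sq_to_K] at e
  -- The Rayleigh quotient shows that `t` is real, and `‖S‖ ≤ 2` puts it in `[0, 4]`.
  have ht' : t = ((‖S v‖ ^ 2 / ‖v‖ ^ 2 : ℝ) : ℂ) := by
    push_cast
    rw [eq_div_iff (by exact_mod_cast (pow_pos hv0 2).ne')]
    exact e.symm
  rw [ht']
  refine stripZerosInBidisc_sq_sub (by positivity) ?_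
  rw [div_le_iff₀ (by positivity)]
  have := S.le_of_opNorm_le hS v
  nlinarith [norm_nonneg (S v)]

/-- On the eigenspace of `μ`, `S² - tP` acts as `μ(S*S - t)`, so the product over the roots is a
power of `μ` times the characteristic polynomial of `S*S`, and Cayley–Hamilton applies. The
polynomial does not depend on `μ`, so it serves all eigenspaces. -/
lemma IsFundamentalOperator.polyEvalHom_modulusPoly_apply (hA : IsFundamentalOperator S P A)
    (hc : Commute S P) (hP : ‖P‖ ≤ 1) {h : H} (hh : h ∈ unimodularEigenspan P) :
    polyEvalHom hc (modulusPoly S) h = 0 := by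
  induction hh using Submodule.span_induction with
  | zero => exact map_zero _
  | add x y _ _ hx hy => rw [map_add, hx, hy, add_zero]
  | smul a x _ hx => rw [map_smul, hx, smul_zero]
  | mem v hv =>
  obtain ⟨μ, hμ, hv⟩ := hv
  set N := (star S * S).toLinearMap with hN
  have hstep : ∀ (t : ℂ) (u : H), P u = μ • u →
      polyEvalHom hc (X 0 ^ 2 - C t * X 1) u = μ • (N u - t • u) := fun t u hu => by
    have h1 : S (S u) = μ • star S (S u) := by
      have : P (S u) = μ • S u := by
        rw [← mul_apply_eq_comp, ← hc.eq, mul_apply_eq_comp, hu, map_smul]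
      exact hA.fst_apply hP hμ this
    simp [polyEvalHom_X_zero, polyEvalHom_X_one, pow_two, hu, h1, hN, smul_sub]
  have hNP : ∀ (u : H), P u = μ • u → P (N u) = μ • N u := fun u hu => by
    refine hA.snd_star_apply hc hP hμ (v := S u) ?_
    rw [← mul_apply_eq_comp, ← hc.eq, mul_apply_eq_comp, hu, map_smul]
  -- The vector stays general because each induction step replaces `u` by `N u - t • u`, again in
  -- the eigenspace.
  have hprod : ∀ m : Multiset ℂ, ∀ u : H, P u = μ • u →
      polyEvalHom hc (m.map fun t => X 0 ^ 2 - C t * X 1).prod u =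
        μ ^ m.card • Polynomial.aeval N (m.map fun t => Polynomial.X - Polynomial.C t).prod u := by
    intro m
    induction m using Multiset.induction with
    | empty => simp
    | cons t m ih =>
      intro u hu
      have hu' : P (N u - t • u) = μ • (N u - t • u) := by
        rw [map_sub, hNP u hu, map_smul, hu, smul_sub, smul_comm]
      rw [Multiset.map_cons, Multiset.prod_cons, mul_comm, map_mul, mul_apply_eq_comp, hstep t u hu,
        map_smul, ih _ hu', Multiset.map_cons, Multiset.prod_cons, mul_comm, map_mul,
        Module.End.mul_apply, Multiset.card_cons, smul_smul, pow_succ, mul_comm μ]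
      simp [Module.algebraMap_end_apply]
  have hsplit : (N.charpoly.roots.map fun t => Polynomial.X - Polynomial.C t).prod =
      N.charpoly :=
    ((IsAlgClosed.splits N.charpoly).eq_prod_roots_of_monic N.charpoly_monic).symm
  rw [modulusPoly, hprod _ v hv, hsplit, LinearMap.aeval_self_charpoly]
  simp

lemma nontrivial_defectSpace (hP : ‖P‖ ≤ 1) (hu : P ∉ unitary (H →L[ℂ] H)) :
    Nontrivial (defectSpace P) := by
  rw [← not_subsingleton_iff_nontrivial]
  intro hs
  have h0 : defectOp P = 0 := by
    ext x
    exact congrArg Subtype.val (Subsingleton.elim (toDefectSpace P x) 0)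
  have h1 : star P * P = 1 := by
    have := defectOp_mul_self hP
    rw [h0, mul_zero, eq_comm, sub_eq_zero] at this
    exact this.symm
  refine hu (Unitary.mem_iff.2 ⟨h1, ?_⟩)
  have h2 : (star P).toLinearMap * P.toLinearMap = 1 := by
    rw [← ContinuousLinearMap.toLinearMap_mul, h1]; rfl
  -- Finite dimension: a left inverse is a right inverse, so the isometry `P` is unitary.
  have h3 := mul_eq_one_comm.1 h2
  ext x
  exact DFunLike.congr_fun h3 x

end FundamentalOperator

end GammaContraction

end

theorem proposition5p12 {H : Type*} [NormedAddCommGroup H] [InnerProductSpace ℂ H]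
    [CompleteSpace H] [FiniteDimensional ℂ H]
    (S P : H →L[ℂ] H) (hSP : IsGammaContraction S P)
    (A : defectSpace P →L[ℂ] defectSpace P) (hA : IsFundamentalOperator S P A)
    (hω : numericalRadius A < 1) :
    IsGammaDistinguished S P ∧
      (P ∉ unitary (H →L[ℂ] H) → IsGammaDistinguishedPoly (pencilPoly A)) ∧
      (∀ h : H, (∀ (μ : ℂ) (v : H), ‖μ‖ = 1 → P v = μ • v → ⟪v, h⟫_ℂ = 0) →
        polyEval (pencilPoly A) S P h = 0) ∧
      ((∀ μ : ℂ, ‖μ‖ = 1 → ¬ Module.End.HasEigenvalue P.toLinearMap μ) →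
        polyEval (pencilPoly A) S P = 0) := by
  have hc := hSP.1
  have hP := hSP.norm_snd_le
  have hf := stripZerosInBidisc_pencilPoly hω
  have hpure : ∀ h : H, (∀ (μ : ℂ) (v : H), ‖μ‖ = 1 → P v = μ • v → ⟪v, h⟫_ℂ = 0) →
      polyEval (pencilPoly A) S P h = 0 := fun h hh => by
    rw [polyEval_eq hc]
    exact hA.polyEvalHom_pencilPoly_apply hc hP (mem_orthogonal_unimodularEigenspan.2 hh)
  refine ⟨⟨hSP, X 0 * modulusPoly S * pencilPoly A, ?_, ?_⟩, fun hu => ?_, hpure, fun hne => ?_⟩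
  -- The factor `X 0` makes the origin a zero in `𝔾₂` even when the other two factors are `1`, as on
  -- the zero space.
  · refine ((stripZerosInBidisc_X.mul (stripZerosInBidisc_modulusPoly hSP.norm_fst_le)).mul
      hf).isGammaDistinguishedPoly ⟨0, ?_, zero_mem_symmetrizedBidisc⟩
    simp [zeroSet]
  · rw [polyEval_eq hc]
    ext h
    obtain ⟨u, hu, w, hw, rfl⟩ := (unimodularEigenspan P).exists_add_mem_mem_orthogonal h
    have h1 : polyEvalHom hc (X 0 * modulusPoly S * pencilPoly A) u = 0 := by
      -- The factors are reordered so that the one annihilating `u` acts first.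
      rw [mul_right_comm, map_mul, mul_apply_eq_comp,
        hA.polyEvalHom_modulusPoly_apply hc hP hu, map_zero]
    have h2 : polyEvalHom hc (X 0 * modulusPoly S * pencilPoly A) w = 0 := by
      rw [map_mul, mul_apply_eq_comp, hA.polyEvalHom_pencilPoly_apply hc hP hw, map_zero]
    rw [map_add, h1, h2, add_zero, zero_apply]
  · have := nontrivial_defectSpace hP hu
    exact hf.isGammaDistinguishedPoly (zeroSet_pencilPoly_inter_nonempty hω)
  · ext h
    refine hpure h fun μ v hμ hv => ?_
    by_contra h0
    refine hne μ hμ (Module.End.hasEigenvalue_of_hasEigenvector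
      ⟨Module.End.mem_eigenspace_iff.2 hv, ?_⟩)
    rintro rfl
    exact h0 (inner_zero_left _)
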